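/- Let $\mathcal U,\mathcal X,\mathcal Y,\mathcal V,\mathcal Z$ be finite sets with $|\mathcal U|=J$, $|\mathcal X|=K$, $|\mathcal Y|=L$, $|\mathcal V|=M$, $|\mathcal Z|=s$, let $\rho:\mathcal U\times\mathcal V\to\mathbb R$ be a distortion measure, let $\ell\ge 1$ and $d\ge 0$ be integers, and let $\log$ be the logarithm to a fixed base greater than $1$. A deterministic source sequence $u=(u_1,u_2,\ldots)$ over $\mathcal U$ is mapped by an arbitrary (deterministic) encoder to a sequence $x=(x_1,x_2,\ldots)$ over $\mathcal X$, which is sent through a discrete memoryless channel with transition probabilities $P(y|x)$, $x\in\mathcal X$, $y\in\mathcal Y$, so that the output $Y^n$ has the law $\prod_{t=1}^nP(y_t|x_t)$. Let $C=\max_{P_X}I(X;Y)$ be its capacity. The decoder has the state set $\mathcal Z$ and a modulo-$\ell$ counter: it starts in a fixed state $z_1\in\mathcal Z$ and, with $\tau=t \bmod \ell$, $$V_{t-d}=f_\tau(Z_t,Y_t)\quad(d<t\le n),\qquad Z_{t+1}=g_\tau(Z_t,Y_t)\quad(1\le t\le n),$$ where $Z_1=z_1$ and $f_\tau:\mathcal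 Z\times\mathcal Y\to\mathcal V$, $g_\tau:\mathcal Z\times\mathcal Y\to\mathcal Z$ are arbitrary. The symbols $V_t$ with $t\le n$ and $t>n-d$, which are not yet reconstructed at time $n$, are arbitrary elements of $\mathcal V$ (possibly depending on $Y^n$). Suppose that $n\ge1$ and that $\ell$ divides $n$. Let $\hat P_{U^\ell}$ be the empirical distribution of the $n/\ell$ non-overlapping blocks $(u_{i\ell+1},\ldots,u_{i\ell+\ell})$, $0\le i<n/\ell$, and let $$\hat D_{U^\ell}(R)=\min\Big\{\tfrac1\ell\,\mathbb E\sum_{j=1}^\ell\rho(U_j,\tilde V_j)\;:\; I(U^\ell;\tilde V^\ell)\le \ell R\Big\},$$ where $(U^\ell,\tilde V^\ell)$ has the law $\hat P_{U^\ell}P_{\tilde V^\ell|U^\ell}$, the minimum is over all conditional distributions $P_{\tilde V^\ell|U^\ell}$ on $\mathcal V^\ell$ given $\mathcal U^\ell$, and $\hat D_{U^\ell}(R)=+\infty$ for $R<0$. Then $$\frac1n\sum_{t=1}^n\mathbb E\,\rho(u_t,V_t)\;\ge\;\hat D_{U^\ell}\Big(C+\frac{2\log s+d\log M}{\ell}+\delta_1(\ell,n)\Big),$$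 where $$\delta_1(\ell,n)=\frac{(JK)^\ell\log L}{\sqrt n}+\frac{(JKL)^\ell\log e}{2n}+o\Big(\frac1{\sqrt n}\Big).$$ Here the $o(1/\sqrt n)$ term, as $n\to\infty$ with $\ell$ fixed, is a function of $n$ that depends only on $\ell$, $J$, $K$, $L$ and the base of the logarithm; it is the same for all channels, distortion measures, source sequences, encoders, decoders, reconstruction alphabets $\mathcal V$, state sets $\mathcal Z$ and delays $d$. -/

import Mathlib

open Filter Asymptotics

namespace SemiDet

noncomputable section

/-- Mutual information, in logarithms to the base `b`, of a pair of finite random variables with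
joint probability mass function `P`. -/
def mutualInfo (b : ℝ) {A B : Type*} [Fintype A] [Fintype B] (P : A → B → ℝ) : ℝ :=
  ∑ x, ∑ y, P x y * Real.logb b (P x y / ((∑ y', P x y') * ∑ x', P x' y))

/-- `W` is a matrix of transition probabilities: each row `W x` is a probability vector. -/
def IsChannel {A B : Type*} [Fintype B] (W : A → B → ℝ) : Prop :=
  ∀ x, W x ∈ stdSimplex ℝ B

/-- Capacity of the discrete memoryless channel `W`: the largest mutual information
`I(X;Y)` over all input distributions `p`. -/
def capacity (b : ℝ) {X Y : Type*} [Fintype X] [Fintype Y] (W : X → Y → ℝ) : ℝ :=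
  sSup ((fun p : X → ℝ => mutualInfo b (fun x y => p x * W x y)) '' stdSimplex ℝ X)

/-- The `i`-th non-overlapping block of length `ℓ` (`i = 0, 1, …`). Sequences are indexed from `0`,
so entry `t` of a sequence is the symbol at time `t + 1`. -/
def block {U : Type*} (ℓ : ℕ) (u : ℕ → U) (i : ℕ) : Fin ℓ → U :=
  fun j => u (i * ℓ + j)

open Classical in
/-- Empirical distribution of the `n / ℓ` non-overlapping `ℓ`-blocks of `u^n`. -/
def empirical {U : Type*} (ℓ n : ℕ) (u : ℕ → U) (a : Fin ℓ → U) : ℝ :=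
  (ℓ : ℝ) / n * ∑ i ∈ Finset.range (n / ℓ), if block ℓ u i = a then 1 else 0

/-- Expected (additive) distortion between `ℓ`-vectors: `a` is drawn from `p`, and given `a`, the
reproduction is drawn from `Q a`. -/
def blockDistortion {U V : Type*} [Fintype U] [Fintype V] (ρ : U → V → ℝ) {ℓ : ℕ}
    (p : (Fin ℓ → U) → ℝ) (Q : (Fin ℓ → U) → (Fin ℓ → V) → ℝ) : ℝ :=
  ∑ a, ∑ c, p a * Q a c * ∑ j, ρ (a j) (c j)

/-- The `ℓ`-th order empirical distortion-rate function of `u^n`: the least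
`(1/ℓ) E ρ(U^ℓ, V^ℓ)` over all conditional distributions `Q` of `V^ℓ` given `U^ℓ` such that
`I(U^ℓ; V^ℓ) ≤ ℓ R`, where `U^ℓ` has the empirical distribution.
It is `⊤` if there is no such `Q` (that is, for `R < 0`). -/
def empiricalDistortionRate (b : ℝ) {U V : Type*} [Fintype U] [Fintype V] (ρ : U → V → ℝ)
    (ℓ n : ℕ) (u : ℕ → U) (R : ℝ) : EReal :=
  ⨅ Q ∈ {Q : (Fin ℓ → U) → (Fin ℓ → V) → ℝ | IsChannel Q ∧
      mutualInfo b (fun a c => empirical ℓ n u a * Q a c) ≤ ℓ * R},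
    ((1 / (ℓ : ℝ) * blockDistortion ρ (empirical ℓ n u) Q : ℝ) : EReal)

/-- A finite-state decoder with state set `Z`, equipped with a modulo-`ℓ` counter. -/
structure Decoder (ℓ : ℕ) (Y Z V : Type*) where
  /-- The initial state `z₁`. -/
  init : Z
  /-- The next-state functions `g_τ`. -/
  next : ZMod ℓ → Z → Y → Z
  /-- The output functions `f_τ`. -/
  out : ZMod ℓ → Z → Y → V

namespace Decoder

variable {ℓ : ℕ} {Y Z V : Type*}

/-- `dec.state y t` is the state `z_{t+1}`: `z_{t+1} = g_τ(z_t, y_t)` with `τ = t mod ℓ`. Only the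
states up to time `n + 1` are meaningful, those after it are never used. -/
def state (dec : Decoder ℓ Y Z V) {n : ℕ} (y : Fin n → Y) : ℕ → Z
  | 0 => dec.init
  | t + 1 =>
    if h : t < n then dec.next ((t + 1 : ℕ) : ZMod ℓ) (dec.state y t) (y ⟨t, h⟩)
    else dec.state y t

/-- The reconstruction with delay `d`: `v_{t-d} = f_τ(z_t, y_t)` with `τ = t mod ℓ` for
`d < t ≤ n`. The last `d` symbols, not yet reconstructed at time `n`, are given by `tail`. -/
def reconstruct (dec : Decoder ℓ Y Z V) (d : ℕ) {n : ℕ} (tail : (Fin n → Y) → ℕ → V)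
    (y : Fin n → Y) (t : ℕ) : V :=
  if h : t + d < n then dec.out ((t + d + 1 : ℕ) : ZMod ℓ) (dec.state y (t + d)) (y ⟨t + d, h⟩)
  else tail y t

end Decoder

/-- Expectation of `F(Y^n)`, where `Y^n` is the output of the memoryless channel `W` for the
input `x^n`. -/
def channelExpectation {X Y : Type*} [Fintype Y] (W : X → Y → ℝ) {n : ℕ} (x : ℕ → X)
    (F : (Fin n → Y) → ℝ) : ℝ :=
  ∑ y : Fin n → Y, (∏ t : Fin n, W (x t) (y t)) * F y

end

end SemiDet

-- Pick one of the $N=n/\ell$ blocks uniformly at random. The source block then has the empirical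
-- law, and the expected block distortion divided by $\ell$ is the time average, so the joint law of
-- source block and reconstructed block competes in the minimum; only its mutual information has to
-- be bounded.
--
-- The reconstructed block is a function of the $\ell$ channel outputs in the block and of side
-- information $S$: the state at the start of the block and the last $d$ symbols of the block, at
-- most $sM^d$ values. By data processing (`mutualInfo_image_le`), the information is at most the
-- divergence of the law of (index, outputs, $S$) from $p(i)\,q(y)/|S|$, where $q$ is the product
-- over positions of the index-averaged output laws. The uniform factor costs at most $\log|S|$,
-- however $S$ depends on the outputs. Since the channel is memoryless, the rest splits into $\ell$
-- single-letter mutual informations, each at most $C$ (`average_divergence_le_capacity`). So rate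
-- $C+(\log s+d\log M)/\ell$ already suffices.

namespace SemiDet

-- Divergence inequalities and data processing

/-- The log-sum inequality. -/
theorem sum_mul_logb_sum_div_sum_le {ι : Type*} {b : ℝ} (hb : 1 < b) (s : Finset ι)
    (α β : ι → ℝ) (hα : ∀ i ∈ s, 0 ≤ α i) (hβ : ∀ i ∈ s, 0 ≤ β i)
    (hαβ : ∀ i ∈ s, β i = 0 → α i = 0) :
    (∑ i ∈ s, α i) * Real.logb b ((∑ i ∈ s, α i) / ∑ i ∈ s, β i)
      ≤ ∑ i ∈ s, α i * Real.logb b (α i / β i) := by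
  have hlb : 0 < Real.log b := Real.log_pos hb
  simp only [Real.logb, ← mul_div_assoc, ← Finset.sum_div]
  refine div_le_div_of_nonneg_right ?_ hlb.le
  rcases (Finset.sum_nonneg hα).eq_or_lt with h0 | hpos
  · have hz := (Finset.sum_eq_zero_iff_of_nonneg hα).1 h0.symm
    rw [← h0, zero_mul, Finset.sum_eq_zero]
    intro i hi
    rw [hz i hi, zero_mul]
  · have hβpos : 0 < ∑ i ∈ s, β i := by
      refine (Finset.sum_nonneg hβ).lt_of_ne fun h => hpos.ne' ?_
      have hz := (Finset.sum_eq_zero_iff_of_nonneg hβ).1 h.symm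
      exact Finset.sum_eq_zero fun i hi => hαβ i hi (hz i hi)
    set r : ℝ := (∑ i ∈ s, α i) / ∑ i ∈ s, β i with hr
    have hrpos : 0 < r := div_pos hpos hβpos
    -- This is $\log t\le t-1$ at $t=r\beta_i/\alpha_i$; since $r$ is the ratio of the sums, the
    -- corrections $\alpha_i-r\beta_i$ add up to zero.
    have key : ∀ i ∈ s, α i * Real.log r + (α i - r * β i) ≤ α i * Real.log (α i / β i) := by
      intro i hi
      rcases (hα i hi).eq_or_lt with h0 | hai
      · rw [← h0]
        nlinarith [mul_nonneg hrpos.le (hβ i hi)]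
      · have hbi : 0 < β i := (hβ i hi).lt_of_ne fun h => hai.ne' (hαβ i hi h.symm)
        have h1 := Real.log_le_sub_one_of_pos (x := r / (α i / β i)) (by positivity)
        rw [Real.log_div hrpos.ne' (by positivity)] at h1
        have h2 : α i * (r / (α i / β i)) = r * β i := by field_simp
        nlinarith [mul_le_mul_of_nonneg_left h1 hai.le]
    have hsum := Finset.sum_le_sum key
    rw [Finset.sum_add_distrib, Finset.sum_sub_distrib, ← Finset.sum_mul, ← Finset.mul_sum,
      hr, div_mul_cancel₀ _ hβpos.ne', sub_self, add_zero] at hsum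
    exact hsum

/-- Replacing the second marginal by another probability vector can only increase the
mutual information functional. -/
theorem mutualInfo_le_of_output {A B : Type*} [Fintype A] [Fintype B] {b : ℝ} (hb : 1 < b)
    (P : A → B → ℝ) (hP : ∀ x y, 0 ≤ P x y) (hP1 : ∑ x, ∑ y, P x y = 1) {q : B → ℝ}
    (hq : q ∈ stdSimplex ℝ B) (hPq : ∀ x y, q y = 0 → P x y = 0) :
    mutualInfo b P ≤ ∑ x, ∑ y, P x y * Real.logb b (P x y / ((∑ y', P x y') * q y)) := by
  -- The excess over the mutual information is the divergence of the second marginal from $q$,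
  -- nonnegative by the log-sum inequality.
  have hterm : ∀ x y, P x y * Real.logb b (P x y / ((∑ y', P x y') * q y)) =
      P x y * Real.logb b (P x y / ((∑ y', P x y') * ∑ x', P x' y)) +
        P x y * Real.logb b ((∑ x', P x' y) / q y) := by
    intro x y
    rcases (hP x y).eq_or_lt with h0 | hpos
    · simp [← h0]
    · have hA : 0 < ∑ y', P x y' :=
        Finset.sum_pos' (fun y' _ => hP x y') ⟨y, Finset.mem_univ _, hpos⟩
      have hB : 0 < ∑ x', P x' y :=
        Finset.sum_pos' (fun x' _ => hP x' y) ⟨x, Finset.mem_univ _, hpos⟩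
      have hqy : 0 < q y := (hq.1 y).lt_of_ne fun h => hpos.ne' (hPq x y h.symm)
      rw [← mul_add, ← Real.logb_mul (by positivity) (by positivity)]
      congr 2
      field_simp
  simp only [hterm, Finset.sum_add_distrib]
  have h2 : ∑ x, ∑ y, P x y * Real.logb b ((∑ x', P x' y) / q y) =
      ∑ y, (∑ x, P x y) * Real.logb b ((∑ x', P x' y) / q y) := by
    rw [Finset.sum_comm]
    simp only [Finset.sum_mul]
  have h3 := sum_mul_logb_sum_div_sum_le hb Finset.univ (fun y => ∑ x, P x y) q
    (fun y _ => Finset.sum_nonneg fun x _ => hP x y) (fun y _ => hq.1 y)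
    (fun y _ h => Finset.sum_eq_zero fun x _ => hPq x y h)
  rw [Finset.sum_comm, hP1, hq.2, div_one, Real.logb_one, mul_zero] at h3
  rw [h2]
  exact le_add_of_nonneg_right h3

open Classical in
/-- Data processing: the mutual information of a pair `(f, g)` of functions of a random element
with law `α` is at most the divergence of `α` from a measure `β` whose image under `(f, g)` is
the product of the first marginal and a probability vector. -/
theorem mutualInfo_image_le {κ A B : Type*} [Fintype κ] [Fintype A] [Fintype B] {b : ℝ}
    (hb : 1 < b) (f : κ → A) (g : κ → B) {α β : κ → ℝ} (hα : α ∈ stdSimplex ℝ κ)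
    (hβ : ∀ k, 0 ≤ β k) (hαβ : ∀ k, β k = 0 → α k = 0) {q : B → ℝ} (hq : q ∈ stdSimplex ℝ B)
    (hβq : ∀ x y, ∑ k with f k = x ∧ g k = y, β k = (∑ k with f k = x, α k) * q y) :
    mutualInfo b (fun x y => ∑ k with f k = x ∧ g k = y, α k)
      ≤ ∑ k, α k * Real.logb b (α k / β k) := by
  have hfib : ∀ F : κ → ℝ, ∑ x, ∑ y, ∑ k with f k = x ∧ g k = y, F k = ∑ k, F k := by
    intro F
    rw [← Fintype.sum_prod_type', ← Finset.sum_fiberwise Finset.univ (fun k => (f k, g k)) F]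
    simp only [Prod.ext_iff]
  have hrow : ∀ x, ∑ y, ∑ k with f k = x ∧ g k = y, α k = ∑ k with f k = x, α k := by
    intro x
    rw [← Finset.sum_fiberwise _ g α]
    simp only [Finset.filter_filter]
  have hzero : ∀ x y, q y = 0 → ∑ k with f k = x ∧ g k = y, α k = 0 := by
    intro x y hy
    have h := hβq x y
    rw [hy, mul_zero, Finset.sum_eq_zero_iff_of_nonneg fun k _ => hβ k] at h
    exact Finset.sum_eq_zero fun k hk => hαβ k (h k hk)
  refine (mutualInfo_le_of_output hb _ (fun x y => Finset.sum_nonneg fun k _ => hα.1 k)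
    ((hfib α).trans hα.2) hq hzero).trans ?_
  rw [← hfib]
  refine Finset.sum_le_sum fun x _ => Finset.sum_le_sum fun y _ => ?_
  rw [hrow, ← hβq]
  -- Log-sum on each fibre of $(f,g)$.
  exact sum_mul_logb_sum_div_sum_le hb _ α β (fun k _ => hα.1 k) (fun k _ => hβ k)
    (fun k _ => hαβ k)

-- Channels and capacity

/-- Mutual information of the input and the output of a channel as an average divergence. -/
theorem mutualInfo_channel {X Y : Type*} [Fintype X] [Fintype Y] (b : ℝ) (p : X → ℝ)
    {W : X → Y → ℝ} (hW : IsChannel W) :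
    mutualInfo b (fun x y => p x * W x y) =
      ∑ x, p x * ∑ y, W x y * Real.logb b (W x y / ∑ x', p x' * W x' y) := by
  unfold mutualInfo
  refine Finset.sum_congr rfl fun x _ => ?_
  rw [Finset.mul_sum]
  refine Finset.sum_congr rfl fun y _ => ?_
  rw [← Finset.mul_sum, (hW x).2, mul_one, mul_assoc]
  by_cases hx : p x = 0
  · simp [hx]
  · rw [mul_div_mul_left _ _ hx]

theorem IsChannel.le_one {X Y : Type*} [Fintype Y] {W : X → Y → ℝ} (hW : IsChannel W) (x : X)
    (y : Y) : W x y ≤ 1 := by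
  rw [← (hW x).2]
  exact Finset.single_le_sum (fun y _ => (hW x).1 y) (Finset.mem_univ y)

/-- Comparison with the uniform output law, using $W\le 1$. It bounds the set whose supremum defines
`capacity`. -/
theorem mutualInfo_channel_le_logb_card {X Y : Type*} [Fintype X] [Fintype Y] {b : ℝ}
    (hb : 1 < b) {p : X → ℝ} (hp : p ∈ stdSimplex ℝ X) {W : X → Y → ℝ} (hW : IsChannel W) :
    mutualInfo b (fun x y => p x * W x y) ≤ Real.logb b (Fintype.card Y) := by
  have hne : Nonempty X := by
    by_contra h
    rw [not_nonempty_iff] at h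
    simpa using hp.2
  have hneY : Nonempty Y := by
    by_contra h
    rw [not_nonempty_iff] at h
    simpa using (hW hne.some).2
  have hL : (0 : ℝ) < Fintype.card Y := by exact_mod_cast Fintype.card_pos
  have hsum : ∑ x, ∑ y, p x * W x y = 1 := by
    simp only [← Finset.mul_sum, (hW _).2, mul_one, hp.2]
  have hq : (fun _ : Y => (Fintype.card Y : ℝ)⁻¹) ∈ stdSimplex ℝ Y :=
    ⟨fun _ => by positivity, by simp [hL.ne']⟩
  refine (mutualInfo_le_of_output hb _ (fun x y => mul_nonneg (hp.1 x) ((hW x).1 y)) hsum hq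
    (fun x y h => absurd h (by positivity))).trans ?_
  calc _ ≤ ∑ x, ∑ y, p x * W x y * Real.logb b (Fintype.card Y) := by
        refine Finset.sum_le_sum fun x _ => Finset.sum_le_sum fun y _ => ?_
        rcases (mul_nonneg (hp.1 x) ((hW x).1 y)).eq_or_lt with h0 | hpos
        · simp [← h0]
        · refine mul_le_mul_of_nonneg_left (Real.logb_le_logb_of_le hb ?_ ?_) hpos.le
          · rw [← Finset.mul_sum, (hW x).2, mul_one]
            have hpx : 0 < p x := (hp.1 x).lt_of_ne fun h => by simp [← h] at hpos
            positivity
          · rw [← Finset.mul_sum, (hW x).2, mul_one]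
            have hpx : 0 < p x := (hp.1 x).lt_of_ne fun h => by simp [← h] at hpos
            rw [mul_div_mul_left _ _ hpx.ne', div_inv_eq_mul]
            exact mul_le_of_le_one_left hL.le (hW.le_one x y)
    _ = Real.logb b (Fintype.card Y) := by
        simp only [← Finset.sum_mul, hsum, one_mul]

theorem mutualInfo_le_capacity {X Y : Type*} [Fintype X] [Fintype Y] {b : ℝ}
    (hb : 1 < b) {p : X → ℝ} (hp : p ∈ stdSimplex ℝ X) {W : X → Y → ℝ} (hW : IsChannel W) :
    mutualInfo b (fun x y => p x * W x y) ≤ capacity b W := by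
  refine le_csSup ⟨Real.logb b (Fintype.card Y), ?_⟩ ⟨p, hp, rfl⟩
  rintro _ ⟨p', hp', rfl⟩
  exact mutualInfo_channel_le_logb_card hb hp' hW

-- Product laws

open Classical in
/-- Marginals of a product of probability vectors along an injective family of coordinates. -/
theorem sum_prod_of_comp_eq {ι κ Y : Type*} [Fintype ι] [Fintype κ] [DecidableEq κ] [Fintype Y]
    {f : κ → Y → ℝ}
    (hf : ∀ t, ∑ z, f t z = 1) {e : ι → κ} (he : Function.Injective e) (y : ι → Y) :
    ∑ ω : κ → Y with ω ∘ e = y, ∏ t, f t (ω t) = ∏ j, f (e j) (y j) := by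
  -- The event is a box: coordinates in the range of `e` are pinned, and the others are free and
  -- contribute a factor 1.
  have hset : (Finset.univ.filter fun ω : κ → Y => ω ∘ e = y) =
      Fintype.piFinset fun t => Finset.univ.filter fun z => ∀ j, e j = t → z = y j := by
    ext ω
    simp only [Finset.mem_filter, Finset.mem_univ, true_and, Fintype.mem_piFinset, funext_iff,
      Function.comp_apply]
    exact ⟨fun h t j hj => hj ▸ h j, fun h j => h _ j rfl⟩
  rw [hset, ← Finset.prod_univ_sum]
  symm
  refine Fintype.prod_of_injective e he _ _ (fun t ht => ?_) fun j => ?_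
  · rw [← hf t]
    refine Finset.sum_congr (Finset.filter_true_of_mem fun z _ j hj => ?_) fun _ _ => rfl
    exact absurd ⟨j, hj⟩ ht
  · have : (Finset.univ.filter fun z => ∀ j', e j' = e j → z = y j') = {y j} := by
      ext z
      simp only [Finset.mem_filter, Finset.mem_univ, true_and, Finset.mem_singleton]
      exact ⟨fun h => h j rfl, fun h j' hj => he hj ▸ h⟩
    rw [this, Finset.sum_singleton]

theorem sum_prod_eq_one {κ Y : Type*} [Fintype κ] [DecidableEq κ] [Fintype Y]
    {f : κ → Y → ℝ}
    (hf : ∀ t, ∑ z, f t z = 1) : ∑ ω : κ → Y, ∏ t, f t (ω t) = 1 := by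
  classical
  rw [← Fintype.prod_sum]
  simp [hf]

/-- Expectation of a function of one coordinate under a product of probability vectors. -/
theorem sum_prod_mul_apply {κ Y : Type*} [Fintype κ] [DecidableEq κ] [Fintype Y]
    {f : κ → Y → ℝ}
    (hf : ∀ t, ∑ z, f t z = 1) (j : κ) (h : Y → ℝ) :
    ∑ ω : κ → Y, (∏ t, f t (ω t)) * h (ω j) = ∑ z, f j z * h z := by
  classical
  rw [← Finset.sum_fiberwise Finset.univ (fun ω : κ → Y => ω j)]
  refine Finset.sum_congr rfl fun z _ => ?_
  have h1 := sum_prod_of_comp_eq hf (e := fun _ : Unit => j)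
    (fun _ _ _ => rfl) (fun _ => z)
  simp only [Finset.univ_unique, Finset.prod_singleton] at h1
  rw [← h1, Finset.sum_mul]
  refine Finset.sum_congr ?_ fun ω hω => ?_
  · ext ω
    simp [funext_iff]
  · have : ω j = z := by simpa [funext_iff] using hω
    rw [this]

/-- The divergence of product probability vectors is the sum of the divergences. -/
theorem sum_prod_mul_logb_prod_div_prod {κ Y : Type*} [Fintype κ] [DecidableEq κ]
    [Fintype Y] (b : ℝ)
    {f r : κ → Y → ℝ} (hf : ∀ t, ∑ z, f t z = 1) (hr : ∀ t z, r t z = 0 → f t z = 0) :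
    ∑ ω : κ → Y, (∏ t, f t (ω t)) * Real.logb b ((∏ t, f t (ω t)) / ∏ t, r t (ω t)) =
      ∑ t, ∑ z, f t z * Real.logb b (f t z / r t z) := by
  classical
  simp only [← sum_prod_mul_apply hf _ fun z => Real.logb b (f _ z / r _ z)]
  rw [Finset.sum_comm]
  refine Finset.sum_congr rfl fun ω _ => ?_
  rw [← Finset.mul_sum]
  by_cases h0 : ∏ t, f t (ω t) = 0
  · simp [h0]
  · replace h0 := Finset.prod_ne_zero_iff.1 h0
    rw [← Finset.prod_div_distrib, Real.logb_prod]
    intro t ht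
    exact div_ne_zero (h0 t ht) fun h => h0 t ht (hr _ _ h)

-- Information carried by a block with side information

open Classical in
/-- If `φ` is applied to the output of a channel together with side information in `S`, then the
mutual information grows by at most the logarithm of the number of values of the side
information. -/
theorem mutualInfo_le_logb_card_add_divergence {I A Y S B : Type*} [Fintype I] [Fintype A]
    [Fintype Y] [Fintype S] [Fintype B] [Nonempty S] {b : ℝ} (hb : 1 < b) {p : I → ℝ}
    (hp : p ∈ stdSimplex ℝ I) (u : I → A) {P : I → Y × S → ℝ} (hP : IsChannel P)
    (φ : Y × S → B) {q : Y → ℝ} (hq : q ∈ stdSimplex ℝ Y)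
    (hPq : ∀ i k, q k.1 = 0 → P i k = 0) :
    mutualInfo b (fun a c => ∑ i with u i = a, p i * ∑ k with φ k = c, P i k)
      ≤ Real.logb b (Fintype.card S) + ∑ i, p i * ∑ y, (∑ w, P i (y, w)) *
          Real.logb b ((∑ w, P i (y, w)) / q y) := by
  have hS : (0 : ℝ) < Fintype.card S := by exact_mod_cast Fintype.card_pos
  have hprod : ∀ (a : A) (c : B) (F : I → Y × S → ℝ),
      ∑ k : I × (Y × S) with u k.1 = a ∧ φ k.2 = c, F k.1 k.2 =
        ∑ i with u i = a, ∑ k with φ k = c, F i k := by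
    intro a c F
    simp only [Finset.sum_filter, Fintype.sum_prod_type, ite_and]
    refine Finset.sum_congr rfl fun i _ => ?_
    split_ifs <;> simp
  have hα : (fun k : I × (Y × S) => p k.1 * P k.1 k.2) ∈ stdSimplex ℝ (I × (Y × S)) := by
    refine ⟨fun k => mul_nonneg (hp.1 _) ((hP _).1 _), ?_⟩
    rw [Fintype.sum_prod_type]
    simp only [← Finset.mul_sum, (hP _).2, mul_one, hp.2]
  have hq1 : ∑ k : Y × S, q k.1 / Fintype.card S = 1 := by
    rw [Fintype.sum_prod_type]
    simp [mul_div_cancel₀ _ hS.ne', hq.2]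
  -- The reference measure makes the index, the outputs and a uniform $S$ independent.
  have h := mutualInfo_image_le hb (fun k : I × (Y × S) => u k.1) (fun k => φ k.2) hα
    (β := fun k => p k.1 * (q k.2.1 / Fintype.card S))
    (fun k => mul_nonneg (hp.1 _) (div_nonneg (hq.1 _) hS.le))
    (fun k hk => ?_) (q := fun c => ∑ k with φ k = c, q k.1 / Fintype.card S)
    ⟨fun c => Finset.sum_nonneg fun k _ => div_nonneg (hq.1 _) hS.le, ?_⟩ (fun a c => ?_)
  · simp only [hprod _ _ fun i k => p i * P i k, ← Finset.mul_sum] at h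
    refine h.trans ?_
    rw [Fintype.sum_prod_type]
    have hone : Real.logb b (Fintype.card S) =
        ∑ i, p i * ∑ y, ∑ w, P i (y, w) * Real.logb b (Fintype.card S) := by
      simp only [← Finset.sum_mul, ← Fintype.sum_prod_type, (hP _).2, hp.2, one_mul]
    rw [hone, ← Finset.sum_add_distrib]
    refine Finset.sum_le_sum fun i _ => ?_
    rw [← mul_add, ← Finset.sum_add_distrib, Fintype.sum_prod_type, Finset.mul_sum]
    refine Finset.sum_le_sum fun y _ => ?_
    rw [Finset.sum_mul, ← Finset.sum_add_distrib, Finset.mul_sum]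
    refine Finset.sum_le_sum fun w _ => ?_
    rw [mul_assoc, ← mul_add]
    rcases (hp.1 i).eq_or_lt with h0 | hpi
    · simp [← h0]
    rcases ((hP i).1 (y, w)).eq_or_lt with h0 | hPi
    · simp [← h0]
    have hqy : 0 < q y := (hq.1 y).lt_of_ne fun h => hPi.ne' (hPq i (y, w) h.symm)
    -- Dropping the conditional probability of $w$ given $y$ leaves only the factor $|S|$ in the
    -- ratio.
    have hle : P i (y, w) ≤ ∑ w, P i (y, w) :=
      Finset.single_le_sum (f := fun w => P i (y, w)) (fun w _ => (hP i).1 (y, w))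
        (Finset.mem_univ w)
    have hsum : 0 < ∑ w, P i (y, w) := hPi.trans_le hle
    refine mul_le_mul_of_nonneg_left (mul_le_mul_of_nonneg_left ?_ hPi.le) hpi.le
    rw [← Real.logb_mul hS.ne' (by positivity)]
    refine Real.logb_le_logb_of_le hb (by positivity) ?_
    rw [mul_div_mul_left _ _ hpi.ne', div_div_eq_mul_div, mul_comm, mul_div_assoc]
    gcongr
  · rcases mul_eq_zero.1 hk with h0 | h0
    · simp [h0]
    · rw [hPq k.1 k.2 ((div_eq_zero_iff.1 h0).resolve_right hS.ne'), mul_zero]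
  · exact (Finset.sum_fiberwise _ _ _).trans hq1
  · rw [hprod a c fun i k => p i * (q k.1 / Fintype.card S), Finset.sum_mul]
    have : ∑ k : I × (Y × S) with u k.1 = a, p k.1 * P k.1 k.2 = ∑ i with u i = a, p i := by
      rw [Finset.sum_filter, Finset.sum_filter, Fintype.sum_prod_type]
      refine Finset.sum_congr rfl fun i _ => ?_
      split_ifs
      · simp only [← Finset.mul_sum, (hP i).2, mul_one]
      · exact Finset.sum_const_zero
    simp only [← Finset.mul_sum, ← Finset.sum_mul, this]

/-- Averaged over `I`, the divergence of the outputs from the product of the averaged output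
distributions is at most the block length times the capacity. -/
theorem average_divergence_le_capacity {I ι X Y : Type*} [Fintype I] [Fintype ι]
    [DecidableEq ι] [Fintype X] [Fintype Y] {b : ℝ} (hb : 1 < b) {p : I → ℝ}
    (hp : p ∈ stdSimplex ℝ I) {W : X → Y → ℝ} (hW : IsChannel W) (x : I → ι → X)
    (hpos : ∀ i, p i ≠ 0) :
    ∑ i, p i * ∑ y : ι → Y, (∏ j, W (x i j) (y j)) * Real.logb b
        ((∏ j, W (x i j) (y j)) / ∏ j, ∑ i', p i' * W (x i' j) (y j))
      ≤ Fintype.card ι * capacity b W := by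
  classical
  have hac : ∀ i j z, ∑ i', p i' * W (x i' j) z = 0 → W (x i j) z = 0 := by
    intro i j z h
    rw [Finset.sum_eq_zero_iff_of_nonneg
      fun i' _ => mul_nonneg (hp.1 i') ((hW _).1 z)] at h
    exact (mul_eq_zero.1 (h i (Finset.mem_univ i))).resolve_left (hpos i)
  have hsplit := fun i => sum_prod_mul_logb_prod_div_prod b
    (f := fun j => W (x i j)) (r := fun j z => ∑ i', p i' * W (x i' j) z)
    (fun j => (hW _).2) (hac i)
  simp only [hsplit, Finset.mul_sum (s := Finset.univ (α := ι))]
  rw [Finset.sum_comm, ← nsmul_eq_mul, ← Finset.card_univ]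
  refine Finset.sum_le_card_nsmul _ _ _ fun j _ => ?_
  -- At position $j$ only the law of the input letter matters; with it as input law, the averaged
  -- divergence is a mutual information of $W$.
  have hmarg : ∀ F : X → ℝ, ∑ a, (∑ i with x i j = a, p i) * F a = ∑ i, p i * F (x i j) := by
    intro F
    rw [← Finset.sum_fiberwise Finset.univ (fun i => x i j)]
    refine Finset.sum_congr rfl fun a _ => ?_
    rw [Finset.sum_mul]
    refine Finset.sum_congr rfl fun i hi => ?_
    rw [(Finset.mem_filter.1 hi).2]
  have hsimplex : (fun a => ∑ i with x i j = a, p i) ∈ stdSimplex ℝ X :=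
    ⟨fun a => Finset.sum_nonneg fun i _ => hp.1 i, (Finset.sum_fiberwise _ _ _).trans hp.2⟩
  refine le_trans (le_of_eq ?_) (mutualInfo_le_capacity hb hsimplex hW)
  rw [mutualInfo_channel b _ hW]
  simp only [hmarg]

open Classical in
/-- A function of an output block of a memoryless channel and of side information in `S` carries,
on average over the blocks, at most `ℓ` times the capacity plus `log |S|`. -/
theorem mutualInfo_blocks_le {I κ ι X Y S A B : Type*} [Fintype I] [Fintype κ] [DecidableEq κ]
    [Fintype ι] [DecidableEq ι] [Fintype X] [Fintype Y] [Fintype S] [Nonempty S] [Fintype A]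
    [Fintype B] {b : ℝ} (hb : 1 < b) {p : I → ℝ} (hp : p ∈ stdSimplex ℝ I) (hpos : ∀ i, p i ≠ 0)
    {W : X → Y → ℝ} (hW : IsChannel W) (x : κ → X) {e : I → ι → κ}
    (he : ∀ i, Function.Injective (e i)) (u : I → A) (side : I → (κ → Y) → S)
    (φ : (ι → Y) × S → B) :
    mutualInfo b (fun a c => ∑ i with u i = a, p i *
        ∑ ω : κ → Y with φ (ω ∘ e i, side i ω) = c, ∏ t, W (x t) (ω t))
      ≤ Real.logb b (Fintype.card S) + Fintype.card ι * capacity b W := by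
  have hW1 : ∀ t, ∑ z, W (x t) z = 1 := fun t => (hW _).2
  have hμ : ∀ ω : κ → Y, 0 ≤ ∏ t, W (x t) (ω t) :=
    fun ω => Finset.prod_nonneg fun t _ => (hW _).1 _
  set P : I → (ι → Y) × S → ℝ :=
    fun i k => ∑ ω : κ → Y with (ω ∘ e i, side i ω) = k, ∏ t, W (x t) (ω t) with hPdef
  have hP : IsChannel P := fun i => ⟨fun k => Finset.sum_nonneg fun ω _ => hμ ω, by
    rw [Finset.sum_fiberwise, sum_prod_eq_one hW1]⟩
  have hmarg : ∀ i y, ∑ w, P i (y, w) = ∏ j, W (x (e i j)) (y j) := by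
    intro i y
    rw [← sum_prod_of_comp_eq hW1 (he i) y, ← Finset.sum_fiberwise _ (side i)]
    simp only [hPdef, Prod.ext_iff, Finset.filter_filter]
  have hfib : ∀ i c, ∑ k with φ k = c, P i k =
      ∑ ω : κ → Y with φ (ω ∘ e i, side i ω) = c, ∏ t, W (x t) (ω t) := by
    intro i c
    rw [← Finset.sum_fiberwise_of_maps_to (t := Finset.univ.filter fun k => φ k = c)
      (g := fun ω : κ → Y => (ω ∘ e i, side i ω)) (by simp)]
    refine Finset.sum_congr rfl fun k hk => Finset.sum_congr ?_ fun _ _ => rfl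
    ext ω
    simp only [Finset.mem_filter, Finset.mem_univ, true_and] at hk ⊢
    exact ⟨fun h => ⟨h ▸ hk, h⟩, fun h => h.2⟩
  set q : (ι → Y) → ℝ := fun y => ∏ j, ∑ i, p i * W (x (e i j)) (y j) with hqdef
  have hterm : ∀ i j z, 0 ≤ p i * W (x (e i j)) z :=
    fun i j z => mul_nonneg (hp.1 i) ((hW _).1 z)
  have hq : q ∈ stdSimplex ℝ (ι → Y) := by
    refine ⟨fun y => Finset.prod_nonneg fun j _ => Finset.sum_nonneg fun i _ => hterm i j _,
      sum_prod_eq_one (f := fun j z => ∑ i, p i * W (x (e i j)) z) fun j => ?_⟩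
    rw [Finset.sum_comm]
    simp only [← Finset.mul_sum, (hW _).2, mul_one, hp.2]
  have hPq : ∀ i k, q k.1 = 0 → P i k = 0 := by
    intro i k hk
    obtain ⟨j, -, hj⟩ := Finset.prod_eq_zero_iff.1 hk
    rw [Finset.sum_eq_zero_iff_of_nonneg fun i _ => hterm i j _] at hj
    have hWj := (mul_eq_zero.1 (hj i (Finset.mem_univ i))).resolve_left (hpos i)
    have h0 := hmarg i k.1
    rw [Finset.prod_eq_zero (Finset.mem_univ j) hWj,
      Finset.sum_eq_zero_iff_of_nonneg fun w _ => (hP i).1 _] at h0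
    exact h0 k.2 (Finset.mem_univ _)
  have h := mutualInfo_le_logb_card_add_divergence hb hp u hP φ hq hPq
  simp only [hfib, hmarg] at h
  exact h.trans (add_le_add_right
    (average_divergence_le_capacity hb hp hW (fun i j => x (e i j)) hpos) _)

-- Restarting the decoder at a block boundary

namespace Decoder

variable {ℓ : ℕ} {Y Z V : Type*}

/-- The states within a block are those of the decoder restarted, on the block, in the state at
the beginning of the block. -/
theorem state_block (dec : Decoder ℓ Y Z V) {n i : ℕ} (h : i * ℓ + ℓ ≤ n) (y : Fin n → Y)
    {j : ℕ} (hj : j ≤ ℓ) :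
    dec.state y (i * ℓ + j) = ({ dec with init := dec.state y (i * ℓ) } : Decoder ℓ Y Z V).state
      (fun k : Fin ℓ => y ⟨i * ℓ + k, by omega⟩) j := by
  induction j with
  | zero => rfl
  | succ j ih =>
    have hn : i * ℓ + j < n := by omega
    have hj' : j < ℓ := hj
    -- Blocks start at multiples of $\ell$, so the counter agrees with that of the restarted
    -- decoder.
    have hmod : ((i * ℓ + j + 1 : ℕ) : ZMod ℓ) = ((j + 1 : ℕ) : ZMod ℓ) := by
      push_cast
      simp
    rw [← add_assoc, state, state, dif_pos hn, dif_pos hj', ih hj'.le, hmod]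

/-- The reconstruction of a block is that of the decoder restarted, on the block, in the state at
the beginning of the block, up to the last `d` symbols of the block. -/
theorem reconstruct_block (dec : Decoder ℓ Y Z V) (d : ℕ) {n i : ℕ} (h : i * ℓ + ℓ ≤ n)
    (tail : (Fin n → Y) → ℕ → V) (y : Fin n → Y) (T : ℕ → V)
    (hT : ∀ j < ℓ, ℓ ≤ j + d → T j = dec.reconstruct d tail y (i * ℓ + j)) {j : ℕ} (hj : j < ℓ) :
    dec.reconstruct d tail y (i * ℓ + j) =
      ({ dec with init := dec.state y (i * ℓ) } : Decoder ℓ Y Z V).reconstruct d (fun _ => T)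
        (fun k : Fin ℓ => y ⟨i * ℓ + k, by omega⟩) j := by
  by_cases hjd : j + d < ℓ
  · have hn : i * ℓ + j + d < n := by omega
    rw [reconstruct, reconstruct, dif_pos hn, dif_pos hjd]
    have hs := dec.state_block h y hjd.le
    simp only [add_assoc] at hs ⊢
    rw [← hs]
    congr 1
    push_cast
    simp
  · conv_rhs => rw [reconstruct, dif_neg hjd]
    exact (hT j hj (not_lt.1 hjd)).symm

end Decoder

-- The empirical block law and the converse

/-- A nonnegative matrix factors as the vector of its row sums times a channel. -/
theorem exists_isChannel_mul_eq {A B : Type*} [Fintype B] [Nonempty B] {P : A → B → ℝ}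
    (hP : ∀ a c, 0 ≤ P a c) :
    ∃ Q : A → B → ℝ, IsChannel Q ∧ ∀ a c, (∑ c', P a c') * Q a c = P a c := by
  classical
  refine ⟨fun a => if ∑ c', P a c' = 0 then Pi.single (Classical.arbitrary B) 1
    else fun c => P a c / ∑ c', P a c', fun a => ?_, fun a c => ?_⟩
  · dsimp only
    split_ifs with h
    · exact single_mem_stdSimplex ℝ _
    · refine ⟨fun c => div_nonneg (hP a c) (Finset.sum_nonneg fun c' _ => hP a c'), ?_⟩
      rw [← Finset.sum_div, div_self h]
  · dsimp only
    split_ifs with h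
    · rw [h, zero_mul]
      exact ((Finset.sum_eq_zero_iff_of_nonneg fun c' _ => hP a c').1 h c (Finset.mem_univ c)).symm
    · exact mul_div_cancel₀ _ h

open Classical in
theorem empirical_mul {U : Type*} {ℓ : ℕ} (hℓ : 0 < ℓ) (N : ℕ) (u : ℕ → U) (a : Fin ℓ → U) :
    empirical ℓ (N * ℓ) u a =
      ∑ _i ∈ Finset.univ.filter (fun i : Fin N => block ℓ u i = a), (N : ℝ)⁻¹ := by
  have hℓ' : (ℓ : ℝ) ≠ 0 := by positivity
  rw [empirical, Nat.mul_div_cancel _ hℓ, Finset.sum_filter,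
    Finset.sum_range (fun i => if block ℓ u i = a then (1 : ℝ) else 0), Finset.mul_sum]
  refine Fintype.sum_congr _ _ fun i => ?_
  split_ifs
  · push_cast
    field_simp
  · simp

theorem sum_range_mul_eq_sum_blocks (N ℓ : ℕ) (F : ℕ → ℝ) :
    ∑ t ∈ Finset.range (N * ℓ), F t = ∑ i : Fin N, ∑ j : Fin ℓ, F (i * ℓ + j) := by
  rw [Finset.sum_range, ← finProdFinEquiv.sum_comp, Fintype.sum_prod_type]
  refine Finset.sum_congr rfl fun i _ => Finset.sum_congr rfl fun j _ => ?_
  congr 1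
  simp only [finProdFinEquiv_apply_val]
  ring

theorem blockIndex_lt {N ℓ : ℕ} (i : Fin N) (j : Fin ℓ) : (i : ℕ) * ℓ + j < N * ℓ :=
  calc (i : ℕ) * ℓ + j < i * ℓ + ℓ := by omega
    _ = (i + 1) * ℓ := by ring
    _ ≤ N * ℓ := Nat.mul_le_mul_right _ i.2

/-- The converse bound without any finite-length correction: the distortion of a finite-state
decoder with delay `d` is at least the empirical distortion-rate function at every rate `R` with
`ℓ R ≥ ℓ C + log |Z| + d log |V|`. -/
theorem empiricalDistortionRate_le_of_capacity_le {U X Y V Z : Type*} [Fintype U] [Fintype X]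
    [Fintype Y] [Fintype V] [Fintype Z] [Nonempty V] {b : ℝ} (hb : 1 < b) {ℓ N : ℕ} (hℓ : 0 < ℓ)
    (hN : 0 < N) (ρ : U → V → ℝ) {W : X → Y → ℝ} (hW : IsChannel W) (u : ℕ → U) (x : ℕ → X)
    (dec : Decoder ℓ Y Z V) (d : ℕ) (tail : (Fin (N * ℓ) → Y) → ℕ → V) {R : ℝ}
    (hR : Real.logb b (Fintype.card Z) + d * Real.logb b (Fintype.card V) + ℓ * capacity b W
      ≤ ℓ * R) :
    empiricalDistortionRate b ρ ℓ (N * ℓ) u R ≤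
      ((1 / ((N * ℓ : ℕ) : ℝ) * ∑ t ∈ Finset.range (N * ℓ), channelExpectation W x
        (fun y : Fin (N * ℓ) → Y => ρ (u t) (dec.reconstruct d tail y t)) : ℝ) : EReal) := by
  classical
  have hneZ : Nonempty Z := ⟨dec.init⟩
  have hN0 : (N : ℝ) ≠ 0 := by positivity
  have hℓ0 : (ℓ : ℝ) ≠ 0 := by positivity
  let e : Fin N → Fin ℓ → Fin (N * ℓ) := fun i j => ⟨i * ℓ + j, blockIndex_lt i j⟩
  have he : ∀ i, Function.Injective (e i) := by
    intro i j j' h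
    have : (i : ℕ) * ℓ + j = i * ℓ + j' := congrArg Fin.val h
    exact Fin.ext (by omega)
  let v : Fin N → (Fin (N * ℓ) → Y) → Fin ℓ → V :=
    fun i ω j => dec.reconstruct d tail ω (i * ℓ + j)
  -- The last symbols are stored backwards from the end of the block. If $d>\ell$, truncated
  -- subtraction merely repeats the first symbol.
  let side : Fin N → (Fin (N * ℓ) → Y) → Z × (Fin d → V) :=
    fun i ω => (dec.state ω (i * ℓ), fun k => dec.reconstruct d tail ω (i * ℓ + (ℓ - 1 - k)))
  -- The arbitrary default is never read: the tail is consulted only when $t+d\ge\ell$, that is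
  -- $\ell-1-t<d$.
  let φ : (Fin ℓ → Y) × (Z × (Fin d → V)) → Fin ℓ → V := fun k j =>
    ({ dec with init := k.2.1 } : Decoder ℓ Y Z V).reconstruct d
      (fun _ t => if h : ℓ - 1 - t < d then k.2.2 ⟨ℓ - 1 - t, h⟩ else Classical.arbitrary V) k.1 j
  have hv : ∀ i ω, φ (ω ∘ e i, side i ω) = v i ω := by
    intro i ω
    funext j
    have hi : (i : ℕ) * ℓ + ℓ ≤ N * ℓ := by
      rw [← Nat.succ_mul]
      exact Nat.mul_le_mul_right _ i.2
    refine (dec.reconstruct_block d hi tail ω _ (fun t ht htd => ?_) j.2).symm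
    have hlt : ℓ - 1 - t < d := by omega
    rw [dif_pos hlt]
    change dec.reconstruct d tail ω (i * ℓ + (ℓ - 1 - (ℓ - 1 - t))) = _
    congr 2
    omega
  have hp : (fun _ : Fin N => (N : ℝ)⁻¹) ∈ stdSimplex ℝ (Fin N) :=
    ⟨fun _ => by positivity, by simp [hN0]⟩
  let μ : (Fin (N * ℓ) → Y) → ℝ := fun ω => ∏ t : Fin (N * ℓ), W (x t) (ω t)
  have hμ : ∀ ω, 0 ≤ μ ω := fun ω => Finset.prod_nonneg fun t _ => (hW _).1 _
  have hμ1 : ∑ ω, μ ω = 1 :=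
    sum_prod_eq_one (f := fun t : Fin (N * ℓ) => W (x t)) fun t => (hW _).2
  let P : (Fin ℓ → U) → (Fin ℓ → V) → ℝ := fun a c =>
    ∑ i ∈ Finset.univ.filter (fun i : Fin N => block ℓ u i = a), (N : ℝ)⁻¹ * ∑ ω with v i ω = c, μ ω
  have hinfo : mutualInfo b P ≤ Real.logb b (Fintype.card (Z × (Fin d → V))) +
      Fintype.card (Fin ℓ) * capacity b W := by
    have h := mutualInfo_blocks_le hb hp (fun _ => inv_ne_zero hN0) hW
      (fun t : Fin (N * ℓ) => x t) he (fun i => block ℓ u i) side φ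
    simp only [hv] at h
    convert h using 2
    funext a c
    simp only [P, μ]
    congr!
  have hrow : ∀ a, ∑ c, P a c = empirical ℓ (N * ℓ) u a := by
    intro a
    rw [empirical_mul hℓ, Finset.sum_comm]
    refine Finset.sum_congr rfl fun i _ => ?_
    rw [← Finset.mul_sum, Finset.sum_fiberwise, hμ1, mul_one]
  -- The test channel is the conditional law of the reconstructed block given the source block.
  obtain ⟨Q, hQ, hPQ⟩ := exists_isChannel_mul_eq (P := P) fun a c =>
    Finset.sum_nonneg fun i _ => mul_nonneg (by positivity) (Finset.sum_nonneg fun ω _ => hμ ω)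
  simp only [hrow] at hPQ
  have hrate : mutualInfo b (fun a c => empirical ℓ (N * ℓ) u a * Q a c) ≤ ℓ * R := by
    simp only [hPQ]
    refine hinfo.trans (le_trans (le_of_eq ?_) hR)
    have hZ : (Fintype.card Z : ℝ) ≠ 0 := by exact_mod_cast Fintype.card_ne_zero
    have hV : (Fintype.card V : ℝ) ≠ 0 := by exact_mod_cast Fintype.card_ne_zero
    rw [Fintype.card_prod, Fintype.card_fun, Fintype.card_fin, Fintype.card_fin]
    push_cast
    rw [Real.logb_mul hZ (pow_ne_zero _ hV), Real.logb_pow]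
  have hexp : ∀ F : (Fin ℓ → U) → (Fin ℓ → V) → ℝ, ∑ a, ∑ c, P a c * F a c =
      (N : ℝ)⁻¹ * ∑ i : Fin N, ∑ ω, μ ω * F (block ℓ u i) (v i ω) := by
    intro F
    rw [Finset.mul_sum, ← Finset.sum_fiberwise Finset.univ (fun i : Fin N => block ℓ u i)]
    refine Finset.sum_congr rfl fun a _ => ?_
    simp only [P, Finset.sum_mul]
    rw [Finset.sum_comm]
    refine Finset.sum_congr rfl fun i hi => ?_
    rw [(Finset.mem_filter.1 hi).2, ← Finset.sum_fiberwise Finset.univ (v i), Finset.mul_sum]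
    refine Finset.sum_congr rfl fun c _ => ?_
    rw [mul_assoc, Finset.sum_mul]
    congr 1
    refine Finset.sum_congr rfl fun ω hω => ?_
    rw [(Finset.mem_filter.1 hω).2]
  refine (iInf₂_le Q ⟨hQ, hrate⟩).trans (le_of_eq ?_)
  congr 1
  rw [sum_range_mul_eq_sum_blocks]
  simp only [blockDistortion, hPQ, hexp fun a c => ∑ j, ρ (a j) (c j), channelExpectation]
  rw [← mul_assoc]
  congr 1
  · push_cast
    field_simp
  · refine Finset.sum_congr rfl fun i _ => ?_
    rw [Finset.sum_comm]
    refine Finset.sum_congr rfl fun ω _ => ?_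
    rw [Finset.mul_sum]
    rfl

end SemiDet

/-- Averaging the joint law of the blocks over the channel outputs gives the bound with the
remainder `r = 0`, the two explicit correction terms being nonnegative. -/
theorem theorem1 (b : ℝ) (hb : 1 < b) (J K L ℓ : ℕ) (hℓ : 0 < ℓ) :
    ∃ r : ℕ → ℝ, (r =o[atTop] fun n : ℕ => 1 / √(n : ℝ)) ∧
      ∀ (U X Y V Z : Type*) [Fintype U] [Fintype X] [Fintype Y] [Fintype V] [Fintype Z],
        Fintype.card U = J → Fintype.card X = K → Fintype.card Y = L →
        ∀ (ρ : U → V → ℝ) (W : X → Y → ℝ), SemiDet.IsChannel W →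
        ∀ (u : ℕ → U) (enc : (ℕ → U) → ℕ → X) (dec : SemiDet.Decoder ℓ Y Z V)
          (d n : ℕ) (tail : (Fin n → Y) → ℕ → V), 0 < n → ℓ ∣ n →
          SemiDet.empiricalDistortionRate b ρ ℓ n u
              (SemiDet.capacity b W
                + (2 * Real.logb b (Fintype.card Z) + d * Real.logb b (Fintype.card V)) / ℓ
                + (((J : ℝ) * K) ^ ℓ * Real.logb b L / √(n : ℝ)
                  + ((J : ℝ) * K * L) ^ ℓ * Real.logb b (Real.exp 1) / (2 * n)
                  + r n))
            ≤ ((1 / (n : ℝ) * ∑ t ∈ Finset.range n,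
                SemiDet.channelExpectation W (enc u)
                  (fun y : Fin n → Y => ρ (u t) (dec.reconstruct d tail y t)) : ℝ) : EReal) := by
  refine ⟨fun _ => 0, isLittleO_zero _ _, ?_⟩
  intro U X Y V Z _ _ _ _ _ _ _ _ ρ W hW u enc dec d n tail hn hdvd
  obtain ⟨N, rfl⟩ := exists_eq_mul_left_of_dvd hdvd
  have hN : 0 < N := Nat.pos_of_mul_pos_right hn
  have hneY : Nonempty Y := by
    by_contra h
    rw [not_nonempty_iff] at h
    simpa using (hW (enc u 0)).2
  have hneV : Nonempty V := ⟨tail (fun _ => hneY.some) 0⟩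
  have hlog : ∀ m : ℕ, 0 ≤ Real.logb b m := by
    intro m
    rcases m.eq_zero_or_pos with rfl | hm
    · simp
    · exact Real.logb_nonneg hb (by exact_mod_cast hm)
  refine SemiDet.empiricalDistortionRate_le_of_capacity_le hb hℓ hN ρ hW u (enc u) dec d tail ?_
  have hℓ' : (0 : ℝ) < ℓ := by exact_mod_cast hℓ
  have hexp : 0 ≤ Real.logb b (Real.exp 1) :=
    Real.logb_nonneg hb (Real.one_le_exp zero_le_one)
  have hδ : 0 ≤ ((J : ℝ) * K) ^ ℓ * Real.logb b L / √((N * ℓ : ℕ) : ℝ)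
      + ((J : ℝ) * K * L) ^ ℓ * Real.logb b (Real.exp 1) / (2 * (N * ℓ : ℕ)) + 0 := by
    have := hlog L
    positivity
  have hmul : ∀ c a δ : ℝ, ℓ * (c + a / ℓ + δ) = ℓ * c + a + ℓ * δ := by
    intro c a δ
    field_simp
  rw [hmul]
  -- One of the two $\log s$ terms is slack, as are both correction terms.
  linarith [hlog (Fintype.card Z), mul_nonneg hℓ'.le hδ]
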